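/- Let $N, M \ge 1$ be integers, let $p=2k$ be an even positive integer, and let $\Phi=\{\varphi_i\}_{i=1}^M$ be unit vectors in $\mathbb{R}^N$ (repetitions are allowed; a finite subset of $S^{N-1}$ is the case of distinct vectors). Let $\sigma$ be the uniform surface measure on $S^{N-1}$ normalized to have mass one. Call $\Phi$ a spherical $p$-design if $$\frac1M\sum_{i=1}^M h(\varphi_i)=\int_{S^{N-1}}h\,d\sigma$$ for every homogeneous real polynomial $h$ in $N$ variables of degree at most $p$. Call a Borel probability measure $\mu$ on $S^{N-1}$ a tight probabilistic $p$-frame if there is a constant $A>0$ such that $$\int_{S^{N-1}}|\langle x,y\rangle|^p\,d\mu(x)=A\|y\|^p\qquad\text{for all } y\in\mathbb{R}^N.$$ Put $\mu_\Phi=\frac1M\sum_{i=1}^M\delta_{\varphi_i}$. 1. If $\Phi$ is a spherical $p$-design, then $\mu_\Phi$ is a tight probabilistic $p$-frame. 2. If $\Phi$ is symmetric, that is, $\{\varphi_i\}_{i=1}^M=\{-\varphi_i\}_{i=1}^M$ (counted with multiplicity), then $\Phi$ is a spherical $p$-design if and only if $\mu_\Phi$ is a tight probabilistic $p$-frame.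 -/

import Mathlib

open MeasureTheory
open scoped ENNReal

noncomputable section

/-- The unit sphere `S^{N-1}` of `ℝ^N`, as a type; it carries its Borel sigma-algebra. -/
abbrev UnitSphere (N : ℕ) : Type :=
  Metric.sphere (0 : EuclideanSpace ℝ (Fin N)) 1

/-- The uniform surface measure on `S^{N-1}`, normalized to have mass one (for `N ≥ 1`). -/
def uniformSphere (N : ℕ) : Measure (UnitSphere N) :=
  ((volume : Measure (EuclideanSpace ℝ (Fin N))).toSphere Set.univ)⁻¹ •
    (volume : Measure (EuclideanSpace ℝ (Fin N))).toSphere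

/-- The value of a polynomial in `N` variables at a point of the sphere. -/
def evalSphere {N : ℕ} (h : MvPolynomial (Fin N) ℝ) (x : UnitSphere N) : ℝ :=
  MvPolynomial.eval (fun j => (x : EuclideanSpace ℝ (Fin N)) j) h

/-- Spherical `t`-design: the average over the points equals the spherical mean for every
homogeneous polynomial of degree at most `t`. Points are indexed, so they may repeat; a finite
subset of the sphere is the case of an injective `φ`. -/
def IsSphericalDesign {N M : ℕ} (t : ℕ) (φ : Fin M → UnitSphere N) : Prop :=
  ∀ d : ℕ, d ≤ t → ∀ h : MvPolynomial (Fin N) ℝ, h.IsHomogeneous d →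
    (1 / (M : ℝ)) * ∑ i, evalSphere h (φ i) = ∫ x, evalSphere h x ∂(uniformSphere N)

/-- `μ` is a probability measure on the sphere and satisfies the `p`-frame inequalities with
bounds `A` and `B`. -/
def HasFrameBounds {N : ℕ} (p : ℝ) (μ : Measure (UnitSphere N)) (A B : ℝ) : Prop :=
  IsProbabilityMeasure μ ∧ 0 < A ∧ 0 < B ∧
    ∀ y : EuclideanSpace ℝ (Fin N),
      A * ‖y‖ ^ p ≤ ∫ x, |inner ℝ (x : EuclideanSpace ℝ (Fin N)) y| ^ p ∂μ ∧
      ∫ x, |inner ℝ (x : EuclideanSpace ℝ (Fin N)) y| ^ p ∂μ ≤ B * ‖y‖ ^ p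

/-- Tight probabilistic `p`-frame: the two frame bounds can be chosen equal. -/
def IsTightProbabilisticFrame {N : ℕ} (p : ℝ) (μ : Measure (UnitSphere N)) : Prop :=
  ∃ A : ℝ, HasFrameBounds p μ A A

/-- The uniform discrete measure `(1 / M) ∑ₖ δ_{φₖ}`. -/
def uniformDiscrete {N M : ℕ} (φ : Fin M → UnitSphere N) : Measure (UnitSphere N) :=
  (M : ℝ≥0∞)⁻¹ • ∑ i, Measure.dirac (φ i)

/-- `{φₖ} = {-φₖ}`, as multisets (for an injective `φ`: as sets). -/
def IsAntipodal {N M : ℕ} (φ : Fin M → UnitSphere N) : Prop :=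
  Finset.univ.val.map φ = Finset.univ.val.map (fun i => -φ i)

end

/-! Rotation invariance of σ makes `∫ ⟪x, y⟫ ^ p ∂σ` a multiple c‖y‖^p
(`integral_inner_pow_uniformSphere`), so testing a design on the powers `⟪·, y⟫ ^ p` gives the tight
frame identity. Conversely, averaging the frame identity over y in the sphere forces A = c, so μ_Φ
and σ integrate these powers equally. Comparing coefficients in y transfers this to every form of
degree p (`integral_evalSphere_eq_of_integral_inner_pow_eq`). A form of lower even degree becomes
one of degree p on multiplying by a power of |x|², which is 1 on the sphere; in odd degree both
sides vanish by symmetry under x ↦ -x. -/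

variable {N M : ℕ}

/-- The linear form `x ↦ ⟪x, y⟫` on `ℝ^N`, as a polynomial. -/
noncomputable def linearForm (y : EuclideanSpace ℝ (Fin N)) : MvPolynomial (Fin N) ℝ :=
  ∑ j, MvPolynomial.C (y j) * MvPolynomial.X j

lemma linearForm_isHomogeneous (y : EuclideanSpace ℝ (Fin N)) :
    (linearForm y).IsHomogeneous 1 :=
  MvPolynomial.IsHomogeneous.sum _ _ _ fun _ _ => MvPolynomial.isHomogeneous_C_mul_X _ _

lemma evalSphere_linearForm_pow (y : EuclideanSpace ℝ (Fin N)) (p : ℕ) (x : UnitSphere N) :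
    evalSphere (linearForm y ^ p) x = (inner ℝ (x : EuclideanSpace ℝ (Fin N)) y) ^ p := by
  simp [evalSphere, linearForm, PiLp.inner_apply]

lemma continuous_evalSphere (h : MvPolynomial (Fin N) ℝ) :
    Continuous (evalSphere h) :=
  (MvPolynomial.continuous_eval h).comp (by fun_prop)

lemma integrable_of_continuous_sphere (μ : Measure (UnitSphere N)) [IsFiniteMeasure μ]
    {f : UnitSphere N → ℝ} (hf : Continuous f) : Integrable f μ :=
  hf.integrable_of_hasCompactSupport (HasCompactSupport.of_compactSpace f)

/-- The polynomial in `y` with value `∫ ⟪x, y⟫ ^ p ∂μ(x)`. -/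
noncomputable def momentPolynomial (μ : Measure (UnitSphere N)) (p : ℕ) : MvPolynomial (Fin N) ℝ :=
  ∑ k ∈ Finset.univ.piAntidiag p,
    MvPolynomial.monomial (Finsupp.equivFunOnFinite.symm k)
      ((Nat.multinomial Finset.univ k : ℝ) *
        ∫ x, ∏ i, ((x : EuclideanSpace ℝ (Fin N)) i) ^ k i ∂μ)

lemma eval_momentPolynomial (μ : Measure (UnitSphere N)) [IsFiniteMeasure μ] (p : ℕ)
    (y : EuclideanSpace ℝ (Fin N)) :
    MvPolynomial.eval (fun j => y j) (momentPolynomial μ p) =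
      ∫ x, (inner ℝ (x : EuclideanSpace ℝ (Fin N)) y) ^ p ∂μ := by
  have expand (x : UnitSphere N) : (inner ℝ (x : EuclideanSpace ℝ (Fin N)) y) ^ p =
      ∑ k ∈ Finset.univ.piAntidiag p, (Nat.multinomial Finset.univ k : ℝ) * (∏ i, y i ^ k i) *
        ∏ i, ((x : EuclideanSpace ℝ (Fin N)) i) ^ k i := by
    simp only [PiLp.inner_apply, RCLike.inner_apply, conj_trivial,
      Finset.sum_pow_eq_sum_piAntidiag, mul_pow, Finset.prod_mul_distrib, mul_assoc]
  simp_rw [expand]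
  rw [integral_finsetSum _ fun k _ =>
    integrable_of_continuous_sphere μ (by fun_prop)]
  simp only [momentPolynomial, map_sum, MvPolynomial.eval_monomial, integral_const_mul]
  refine Finset.sum_congr rfl fun k _ => ?_
  rw [Finsupp.prod_fintype _ _ (by simp)]
  simp only [Finsupp.equivFunOnFinite_symm_apply_apply]
  ring

lemma coeff_momentPolynomial (μ : Measure (UnitSphere N)) {p : ℕ} {d : Fin N →₀ ℕ}
    (hd : ∑ i, d i = p) :
    (momentPolynomial μ p).coeff d = (Nat.multinomial Finset.univ d : ℝ) *
      ∫ x, ∏ i, ((x : EuclideanSpace ℝ (Fin N)) i) ^ d i ∂μ := by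
  simp only [momentPolynomial, MvPolynomial.coeff_sum, MvPolynomial.coeff_monomial]
  rw [Finset.sum_eq_single (d : Fin N → ℕ)]
  · simp
  · intro k _ hk
    rw [if_neg]
    rintro rfl
    exact hk (by ext i; simp)
  · intro h
    simp [hd] at h

lemma sum_eq_of_mem_support {p : ℕ} {h : MvPolynomial (Fin N) ℝ} (hh : h.IsHomogeneous p)
    {d : Fin N →₀ ℕ} (hd : d ∈ h.support) : ∑ i, d i = p := by
  rw [hh.degree_eq_sum_deg_support hd]
  exact (Finset.sum_subset (Finset.subset_univ _) fun i _ hi => by simpa using hi).symm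

/-- The integrals of the `p`-th powers of linear forms determine the integrals of all
homogeneous polynomials of degree `p`. -/
lemma integral_evalSphere_eq_of_integral_inner_pow_eq {μ ν : Measure (UnitSphere N)}
    [IsFiniteMeasure μ] [IsFiniteMeasure ν] {p : ℕ}
    (H : ∀ y : EuclideanSpace ℝ (Fin N),
      ∫ x, (inner ℝ (x : EuclideanSpace ℝ (Fin N)) y) ^ p ∂μ =
        ∫ x, (inner ℝ (x : EuclideanSpace ℝ (Fin N)) y) ^ p ∂ν)
    {h : MvPolynomial (Fin N) ℝ} (hh : h.IsHomogeneous p) :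
    ∫ x, evalSphere h x ∂μ = ∫ x, evalSphere h x ∂ν := by
  -- Over the infinite field ℝ, equality of values gives equality of coefficients: monomial moments
  -- times nonzero multinomials.
  have hQ : momentPolynomial μ p = momentPolynomial ν p := by
    refine MvPolynomial.funext fun y => ?_
    simpa only [← eval_momentPolynomial] using H (WithLp.toLp 2 y)
  simp only [evalSphere, MvPolynomial.eval_eq']
  rw [integral_finsetSum _ fun k _ => integrable_of_continuous_sphere μ (by fun_prop),
    integral_finsetSum _ fun k _ => integrable_of_continuous_sphere ν (by fun_prop)]
  refine Finset.sum_congr rfl fun d hd => ?_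
  have hdp := sum_eq_of_mem_support hh hd
  have hc := congrArg (MvPolynomial.coeff d) hQ
  rw [coeff_momentPolynomial μ hdp, coeff_momentPolynomial ν hdp] at hc
  rw [integral_const_mul, integral_const_mul,
    mul_left_cancel₀ (Nat.cast_ne_zero.2 (Nat.multinomial_pos _ _).ne') hc]

/-- The action of a linear isometry on the unit sphere. -/
noncomputable def sphereMap (g : EuclideanSpace ℝ (Fin N) ≃ₗᵢ[ℝ] EuclideanSpace ℝ (Fin N))
    (x : UnitSphere N) : UnitSphere N :=
  ⟨g x, by simp⟩

lemma continuous_sphereMap (g : EuclideanSpace ℝ (Fin N) ≃ₗᵢ[ℝ] EuclideanSpace ℝ (Fin N)) :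
    Continuous (sphereMap g) :=
  (g.continuous.comp continuous_subtype_val).subtype_mk _

open scoped Pointwise in
-- Surface measure is a multiple of the volume of the cone over a set; `g` preserves volume and
-- commutes with scaling.
lemma toSphere_preimage_sphereMap
    (g : EuclideanSpace ℝ (Fin N) ≃ₗᵢ[ℝ] EuclideanSpace ℝ (Fin N))
    {s : Set (UnitSphere N)} (hs : MeasurableSet s) :
    (volume : Measure (EuclideanSpace ℝ (Fin N))).toSphere (sphereMap g ⁻¹' s) =
      (volume : Measure (EuclideanSpace ℝ (Fin N))).toSphere s := by
  rw [Measure.toSphere_apply' _ hs,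
    Measure.toSphere_apply' _ ((continuous_sphereMap g).measurable hs)]
  have key : (Set.Ioo (0 : ℝ) 1 • (Subtype.val '' (sphereMap g ⁻¹' s)) :
      Set (EuclideanSpace ℝ (Fin N))) =
        g ⁻¹' (Set.Ioo (0 : ℝ) 1 • (Subtype.val '' s)) := by
    ext z
    simp only [Set.mem_smul, Set.mem_image, Set.mem_preimage]
    constructor
    · rintro ⟨r, hr, _, ⟨x, hx, rfl⟩, rfl⟩
      exact ⟨r, hr, _, ⟨_, hx, rfl⟩, (map_smul g r _).symm⟩
    · rintro ⟨r, hr, _, ⟨x, hx, rfl⟩, hz⟩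
      refine ⟨r, hr, _, ⟨sphereMap g.symm x, ?_, rfl⟩, ?_⟩
      · simpa [sphereMap] using hx
      · apply g.injective
        simpa [sphereMap] using hz
  rw [key, g.measurePreserving.measure_preimage_emb g.toHomeomorph.measurableEmbedding]

lemma map_sphereMap_uniformSphere
    (g : EuclideanSpace ℝ (Fin N) ≃ₗᵢ[ℝ] EuclideanSpace ℝ (Fin N)) :
    (uniformSphere N).map (sphereMap g) = uniformSphere N := by
  ext s hs
  rw [Measure.map_apply (continuous_sphereMap g).measurable hs]
  simp only [uniformSphere, Measure.smul_apply, toSphere_preimage_sphereMap g hs]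

lemma integral_comp_sphereMap
    (g : EuclideanSpace ℝ (Fin N) ≃ₗᵢ[ℝ] EuclideanSpace ℝ (Fin N))
    {f : UnitSphere N → ℝ} (hf : Continuous f) :
    ∫ x, f (sphereMap g x) ∂(uniformSphere N) = ∫ x, f x ∂(uniformSphere N) := by
  conv_rhs => rw [← map_sphereMap_uniformSphere g]
  exact (integral_map (continuous_sphereMap g).aemeasurable hf.aestronglyMeasurable).symm

/-- The point `e` rules out N = 0, where the sphere is empty. -/
lemma isProbabilityMeasure_uniformSphere (e : UnitSphere N) :
    IsProbabilityMeasure (uniformSphere N) := by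
  have : Nontrivial (EuclideanSpace ℝ (Fin N)) :=
    ⟨e, 0, ne_zero_of_mem_unit_sphere e⟩
  constructor
  rw [uniformSphere, Measure.smul_apply, smul_eq_mul]
  exact ENNReal.inv_mul_cancel
    (Measure.measure_univ_ne_zero.2 (Measure.toSphere_ne_zero _)) (measure_ne_top _ _)

lemma integral_inner_pow_uniformSphere_of_norm_eq (p : ℕ) {y z : EuclideanSpace ℝ (Fin N)}
    (h : ‖y‖ = ‖z‖) :
    ∫ x, (inner ℝ (x : EuclideanSpace ℝ (Fin N)) y) ^ p ∂(uniformSphere N) =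
      ∫ x, (inner ℝ (x : EuclideanSpace ℝ (Fin N)) z) ^ p ∂(uniformSphere N) := by
  -- Reflection in the hyperplane orthogonal to `y - z` swaps two vectors of equal norm.
  set g := (ℝ ∙ (y - z))ᗮ.reflection with hg
  have hgy : g y = z := Submodule.reflection_sub h
  rw [← integral_comp_sphereMap g
    (f := fun x => (inner ℝ (x : EuclideanSpace ℝ (Fin N)) z) ^ p) (by fun_prop)]
  refine integral_congr_ae (.of_forall fun x => ?_)
  simp only [sphereMap, ← hgy, LinearIsometryEquiv.inner_map_map]

lemma integral_inner_pow_uniformSphere (p : ℕ) (e : UnitSphere N)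
    (y : EuclideanSpace ℝ (Fin N)) :
    ∫ x, (inner ℝ (x : EuclideanSpace ℝ (Fin N)) y) ^ p ∂(uniformSphere N) =
      (∫ x, (inner ℝ (x : EuclideanSpace ℝ (Fin N)) (e : EuclideanSpace ℝ (Fin N))) ^ p
        ∂(uniformSphere N)) * ‖y‖ ^ p := by
  rw [integral_inner_pow_uniformSphere_of_norm_eq p
    (z := ‖y‖ • (e : EuclideanSpace ℝ (Fin N))) (by simp [norm_smul])]
  simp only [inner_smul_right, mul_pow, integral_const_mul]
  ring

lemma isProbabilityMeasure_uniformDiscrete (hM : 0 < M) (φ : Fin M → UnitSphere N) :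
    IsProbabilityMeasure (uniformDiscrete φ) := by
  constructor
  simp only [uniformDiscrete, Measure.smul_apply, Measure.finsetSum_apply, measure_univ,
    Finset.sum_const, Finset.card_univ, Fintype.card_fin, smul_eq_mul, nsmul_eq_mul, mul_one]
  exact ENNReal.inv_mul_cancel (by simpa using hM.ne') (by simp)

lemma integral_uniformDiscrete (φ : Fin M → UnitSphere N) {f : UnitSphere N → ℝ}
    (hf : Continuous f) :
    ∫ x, f x ∂(uniformDiscrete φ) = (1 / (M : ℝ)) * ∑ i, f (φ i) := by
  rw [uniformDiscrete, integral_smul_measure,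
    integral_finsetSum_measure fun i _ => integrable_of_continuous_sphere _ hf]
  simp

lemma isSphericalDesign_iff (φ : Fin M → UnitSphere N) (t : ℕ) :
    IsSphericalDesign t φ ↔ ∀ d ≤ t, ∀ h : MvPolynomial (Fin N) ℝ, h.IsHomogeneous d →
      ∫ x, evalSphere h x ∂(uniformDiscrete φ) = ∫ x, evalSphere h x ∂(uniformSphere N) := by
  simp only [IsSphericalDesign, integral_uniformDiscrete φ (continuous_evalSphere _)]

lemma isTightProbabilisticFrame_iff_of_even {p : ℕ} (hp : Even p) {μ : Measure (UnitSphere N)}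
    [IsProbabilityMeasure μ] :
    IsTightProbabilisticFrame (p : ℝ) μ ↔ ∃ A : ℝ, 0 < A ∧ ∀ y : EuclideanSpace ℝ (Fin N),
      ∫ x, (inner ℝ (x : EuclideanSpace ℝ (Fin N)) y) ^ p ∂μ = A * ‖y‖ ^ p := by
  simp only [IsTightProbabilisticFrame, HasFrameBounds, Real.rpow_natCast, hp.pow_abs]
  refine exists_congr fun A => ⟨fun ⟨_, hA, _, h⟩ => ⟨hA, fun y => ?_⟩, fun ⟨hA, h⟩ => ?_⟩
  · exact le_antisymm (h y).2 (h y).1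
  · exact ⟨inferInstance, hA, hA, fun y => ⟨(h y).ge, (h y).le⟩⟩

lemma IsSphericalDesign.isTightProbabilisticFrame {p : ℕ} (hM : 0 < M) (hp : Even p)
    {φ : Fin M → UnitSphere N} (hφ : IsSphericalDesign p φ) :
    IsTightProbabilisticFrame (p : ℝ) (uniformDiscrete φ) := by
  have := isProbabilityMeasure_uniformDiscrete hM φ
  rw [isTightProbabilisticFrame_iff_of_even hp]
  have hint (y : EuclideanSpace ℝ (Fin N)) :
      ∫ x, (inner ℝ (x : EuclideanSpace ℝ (Fin N)) y) ^ p ∂(uniformDiscrete φ) =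
        ∫ x, (inner ℝ (x : EuclideanSpace ℝ (Fin N)) y) ^ p ∂(uniformSphere N) := by
    simpa only [evalSphere_linearForm_pow] using (isSphericalDesign_iff φ p).1 hφ p le_rfl
      (linearForm y ^ p) (by simpa using (linearForm_isHomogeneous y).pow p)
  refine ⟨_, ?_, fun y => (hint y).trans (integral_inner_pow_uniformSphere p (φ ⟨0, hM⟩) y)⟩
  -- By the design property the constant is an average of nonnegative terms, the one at index 0
  -- being `‖φ 0‖ ^ (2p) = 1`.
  rw [← hint, integral_uniformDiscrete φ (by fun_prop)]
  refine mul_pos (by positivity)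
    (Finset.sum_pos' (fun i _ => hp.pow_nonneg _) ⟨⟨0, hM⟩, Finset.mem_univ _, ?_⟩)
  simp

/-- `(x₁² + ⋯ + x_N²) ^ m`, which is `1` on the sphere. -/
noncomputable def normSqPow (N m : ℕ) : MvPolynomial (Fin N) ℝ :=
  (∑ j, MvPolynomial.X j ^ 2) ^ m

lemma normSqPow_isHomogeneous (m : ℕ) : (normSqPow N m).IsHomogeneous (2 * m) :=
  (MvPolynomial.IsHomogeneous.sum _ _ _ fun j _ => MvPolynomial.isHomogeneous_X_pow j 2).pow m

lemma evalSphere_mul_normSqPow (h : MvPolynomial (Fin N) ℝ) (m : ℕ) (x : UnitSphere N) :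
    evalSphere (h * normSqPow N m) x = evalSphere h x := by
  have hx : ∑ j, ((x : EuclideanSpace ℝ (Fin N)) j) ^ 2 = 1 := by
    rw [← EuclideanSpace.real_norm_sq_eq]; simp
  simp [evalSphere, normSqPow, hx]

lemma evalSphere_neg_of_odd {d : ℕ} (hd : Odd d) {h : MvPolynomial (Fin N) ℝ}
    (hh : h.IsHomogeneous d) (x : UnitSphere N) : evalSphere h (-x) = -evalSphere h x := by
  simp only [evalSphere, MvPolynomial.eval_eq', ← Finset.sum_neg_distrib]
  refine Finset.sum_congr rfl fun k hk => ?_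
  have hprod : ∏ i, ((-x : UnitSphere N) : EuclideanSpace ℝ (Fin N)) i ^ k i =
      (-1) ^ d * ∏ i, (x : EuclideanSpace ℝ (Fin N)) i ^ k i := by
    rw [← sum_eq_of_mem_support hh hk, ← Finset.prod_pow_eq_pow_sum, ← Finset.prod_mul_distrib]
    simp [← mul_pow]
  rw [hprod, hd.neg_one_pow]
  ring

lemma integral_evalSphere_uniformSphere_of_odd {d : ℕ} (hd : Odd d)
    {h : MvPolynomial (Fin N) ℝ} (hh : h.IsHomogeneous d) :
    ∫ x, evalSphere h x ∂(uniformSphere N) = 0 := by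
  have H := integral_comp_sphereMap (LinearIsometryEquiv.neg ℝ) (continuous_evalSphere h)
  have hneg (x : UnitSphere N) : sphereMap (LinearIsometryEquiv.neg ℝ) x = -x := rfl
  simp only [hneg, evalSphere_neg_of_odd hd hh, integral_neg] at H
  linarith

lemma IsAntipodal.sum_evalSphere_of_odd {φ : Fin M → UnitSphere N} (hφ : IsAntipodal φ)
    {d : ℕ} (hd : Odd d) {h : MvPolynomial (Fin N) ℝ} (hh : h.IsHomogeneous d) :
    ∑ i, evalSphere h (φ i) = 0 := by
  have H := congrArg (fun s => (s.map (evalSphere h)).sum) hφ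
  simp only [Multiset.map_map, Function.comp_def, evalSphere_neg_of_odd hd hh] at H
  change ∑ i, evalSphere h (φ i) = ∑ i, -evalSphere h (φ i) at H
  rw [Finset.sum_neg_distrib] at H
  linarith

lemma IsAntipodal.isSphericalDesign {p : ℕ} (hM : 0 < M) (hp : Even p)
    {φ : Fin M → UnitSphere N} (hφ : IsAntipodal φ)
    (hframe : IsTightProbabilisticFrame (p : ℝ) (uniformDiscrete φ)) :
    IsSphericalDesign p φ := by
  have := isProbabilityMeasure_uniformDiscrete hM φ
  have := isProbabilityMeasure_uniformSphere (φ ⟨0, hM⟩)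
  obtain ⟨A, -, hA⟩ := (isTightProbabilisticFrame_iff_of_even hp).1 hframe
  have hσ := integral_inner_pow_uniformSphere p (φ ⟨0, hM⟩)
  set c := ∫ x, (inner ℝ (x : EuclideanSpace ℝ (Fin N))
    (φ ⟨0, hM⟩ : EuclideanSpace ℝ (Fin N))) ^ p ∂(uniformSphere N)
  have hAc : A = c := by
    -- The integrand is constantly A; integrated termwise, each summand gives c because `‖φ i‖ = 1`.
    have h1 : ∫ y : UnitSphere N, (1 / (M : ℝ)) * ∑ i,
        (inner ℝ (φ i : EuclideanSpace ℝ (Fin N)) (y : EuclideanSpace ℝ (Fin N))) ^ p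
          ∂(uniformSphere N) = A := by
      have (y : UnitSphere N) : (1 / (M : ℝ)) * ∑ i,
          (inner ℝ (φ i : EuclideanSpace ℝ (Fin N)) (y : EuclideanSpace ℝ (Fin N))) ^ p = A := by
        rw [← integral_uniformDiscrete φ (f := fun x : UnitSphere N =>
          (inner ℝ (x : EuclideanSpace ℝ (Fin N)) (y : EuclideanSpace ℝ (Fin N))) ^ p)
          (by fun_prop), hA]
        simp
      simp only [this, integral_const, probReal_univ, one_smul]
    rw [integral_const_mul, integral_finsetSum _ fun i _ =>
      integrable_of_continuous_sphere _ (by fun_prop)] at h1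
    simp_rw [real_inner_comm, hσ] at h1
    have hM' : (M : ℝ) ≠ 0 := Nat.cast_ne_zero.2 hM.ne'
    simpa [hM'] using h1.symm
  rw [isSphericalDesign_iff]
  intro d hd h hh
  rcases Nat.even_or_odd d with hd2 | hd2
  · obtain ⟨m, hm⟩ := ((Nat.even_sub hd).2 (iff_of_true hp hd2)).two_dvd
    have hhom : (h * normSqPow N m).IsHomogeneous p := by
      convert hh.mul (normSqPow_isHomogeneous m) using 1
      omega
    simpa only [evalSphere_mul_normSqPow] using
      integral_evalSphere_eq_of_integral_inner_pow_eq
        (fun y => by rw [hA, hσ, hAc]) hhom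
  · rw [integral_uniformDiscrete φ (continuous_evalSphere h), hφ.sum_evalSphere_of_odd hd2 hh,
      integral_evalSphere_uniformSphere_of_odd hd2 hh, mul_zero]

theorem mainTheorem1 (N M p : ℕ) (hM : 0 < M) (hp : 0 < p) (hp_even : Even p)
    (φ : Fin M → UnitSphere N) :
    (IsSphericalDesign p φ → IsTightProbabilisticFrame (p : ℝ) (uniformDiscrete φ)) ∧
    (IsAntipodal φ →
      (IsSphericalDesign p φ ↔ IsTightProbabilisticFrame (p : ℝ) (uniformDiscrete φ))) :=
  ⟨fun h => h.isTightProbabilisticFrame hM hp_even, fun hφ =>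
    ⟨fun h => h.isTightProbabilisticFrame hM hp_even, hφ.isSphericalDesign hM hp_even⟩⟩
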